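/- **Theorem.** Let $F$ be a field and let $\mathcal C\subseteq F^n$ be an $[n,k,d]$ linear code, i.e. a linear subspace of dimension $k$ with at least two codewords and minimum Hamming distance $d$ (so $k\ge 1$). For $S\subseteq\{1,\dots,n\}$ let $\mathcal C|_S$ be the punctured code obtained by deleting the coordinates outside $S$; the zero code is regarded as having minimum distance $+\infty$. For positive integers $r_\ell,\delta_\ell$, say that a code $\mathcal C|_S$ has *$1$-level hierarchical locality* with parameters $[(r_1,\delta_1)]$ if every $i\in S$ lies in some $T\subseteq S$ with $\dim \mathcal C|_T\le r_1$ and $d_{\min}(\mathcal C|_T)\ge\delta_1$; and, for $h\ge 2$, that it has *$h$-level hierarchical locality* with parameters $[(r_1,\delta_1),\dots,(r_h,\delta_h)]$ if every $i\in S$ lies in some $T\subseteq S$ with $\dim \mathcal C|_T\le r_1$, $d_{\min}(\mathcal C|_T)\ge\delta_1$, and such that $\mathcal C|_T$ has $(h-1)$-level hierarchical locality with parameters $[(r_2,\delta_2),\dots,(r_h,\delta_h)]$. Let $h\ge 1$ and suppose that $\mathcal C=\mathcal C|_{\{1,\dots,n\}}$ has $h$-level hierarchical locality with parameters $[(r_1,\delta_1),\dots,(r_h,\delta_h)]$,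 where all $r_\ell,\delta_\ell$ are positive integers. If $h\ge 3$, suppose moreover that $r_1\ge r_2\ge\dots\ge r_h$ or that $\delta_1\ge\delta_2\ge\dots\ge\delta_h$. Then $$ d\;\le\; n-k+1-\sum_{\ell=1}^{h-1}\left(\left\lceil \frac{k}{r_\ell}\right\rceil-1\right)(\delta_\ell-\delta_{\ell+1})-\left(\left\lceil \frac{k}{r_h}\right\rceil-1\right)(\delta_h-1). $$ -/

import Mathlib

namespace HierLoc

/-- The punctured code `C|_S`: the code `C` of length `|ι|` with all coordinates outside
`S` deleted. -/
def puncture {F ι : Type*} [Field F] (C : Submodule F (ι → F)) (S : Finset ι) :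
    Submodule F (S → F) :=
  C.map (LinearMap.funLeft F F (Subtype.val : S → ι))

/-- Minimum Hamming distance between two distinct codewords; it is `⊤` when there is only one
codeword (the zero code), so that a lower bound on it is then vacuous. -/
noncomputable def minDist {F ι : Type*} [Field F] [DecidableEq F] [Fintype ι]
    (C : Submodule F (ι → F)) : ℕ∞ :=
  ⨅ x ∈ C, ⨅ y ∈ C, ⨅ _ : x ≠ y, (hammingDist x y : ℕ∞)

/-- `C` is an `[n, k, d]` linear code over the field `F`. As `d` is finite, `C` is nonzero. -/
structure IsLinearCode {F : Type*} [Field F] [DecidableEq F] (n k d : ℕ)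
    (C : Submodule F (Fin n → F)) : Prop where
  dim_eq : Module.finrank F C = k
  minDist_eq : minDist C = (d : ℕ∞)

/-- The punctured code `C|_S` has `(r, δ)`-locality: every coordinate `i ∈ S` lies in the
index set `T` of a punctured code of `C|_S`, of dimension at most `r` and of minimum distance at
least `δ`. (The punctured codes of `C|_S` are the `C|_T` with `T ⊆ S`.) -/
def LocalityOn {F ι : Type*} [Field F] [DecidableEq F]
    (C : Submodule F (ι → F)) (r δ : ℕ) (S : Finset ι) : Prop :=
  ∀ i ∈ S, ∃ T ⊆ S, i ∈ T ∧
    Module.finrank F (puncture C T) ≤ r ∧ (δ : ℕ∞) ≤ minDist (puncture C T)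

/-- The punctured code `C|_S` has `(m + 1)`-level hierarchical locality with parameters
`[(r 0, δ 0), …, (r m, δ m)]`, the outermost level first. One level is `(r, δ)`-locality; with more
levels, the local codes `C|_T` themselves have hierarchical locality for the remaining
parameters. -/
def HierarchicalLocalityOn {F ι : Type*} [Field F] [DecidableEq F]
    (C : Submodule F (ι → F)) :
    (m : ℕ) → (r δ : Fin (m + 1) → ℕ) → Finset ι → Prop
  | 0, r, δ, S => LocalityOn C (r 0) (δ 0) S
  | m + 1, r, δ, S => ∀ i ∈ S, ∃ T ⊆ S, i ∈ T ∧
      Module.finrank F (puncture C T) ≤ r 0 ∧ (δ 0 : ℕ∞) ≤ minDist (puncture C T) ∧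
      HierarchicalLocalityOn C m (Fin.tail r) (Fin.tail δ) T

/-- The code `C` has `(m + 1)`-level hierarchical locality with parameters
`[(r 0, δ 0), …, (r m, δ m)]`. -/
def HasHierarchicalLocality {F ι : Type*} [Field F] [DecidableEq F] [Fintype ι]
    (C : Submodule F (ι → F)) (m : ℕ) (r δ : Fin (m + 1) → ℕ) : Prop :=
  HierarchicalLocalityOn C m r δ Finset.univ

end HierLoc

/-!
Write `rank S` for the dimension of `C|_S`, and let `gain L k` be the quantity subtracted in the
bound when the levels are listed in `L`, outermost first.

Assume first that the distances `δ` decrease along `L`. The bound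
`d + rank S + gain L (rank S) ≤ |S| + 1` is proved by induction on the number of levels and then on
`rank S`; with no levels it is the Singleton bound. Take an outermost local code `C|_T` that is not
zero.

* If `rank T = rank S`, passing to `T` costs at most `|S \ T|` in the distance, and `rank S ≤ r₁`
  makes the first term of the gain vanish, so the bound with one level fewer, applied to `T`,
  suffices.
* Otherwise shorten `C` at `T`: the codewords vanishing on `T` form a code on `S \ T` of dimension
  `rank S - rank T`, which has distance at least `d` and the same locality. Its bound, added to the
  bound with one level fewer for `T` (whose distance is at least `δ₁`), gives the claim, because
  ceilings are subadditive (`gain_add_le`).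

The remaining cases reduce to this one. A local code of an inner level sits inside one of the outer
levels, so its dimension is bounded by all outer `r` too: each `r` may be replaced by the minimum of
itself and its predecessors (`capDim`). Conversely, a nonzero codeword of an outer local code is
nonzero on some inner local code, so each `δ` may be replaced by the maximum of itself and its
successors (`raiseDist`). The first replacement does not decrease the gain if `δ` decreases, if `r`
decreases, or if there are at most two levels; the second does not decrease it as soon as `r`
decreases, which holds after the first.
-/

namespace HierLoc

open Module

/-! ### Dimension of punctured and shortened codes -/

section Rank

variable {F ι : Type*} [Field F]

/-- The words that vanish on the coordinates in `S`. -/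
def vanishing (F : Type*) {ι : Type*} [Field F] (S : Finset ι) : Submodule F (ι → F) :=
  LinearMap.ker (LinearMap.funLeft F F (Subtype.val : S → ι))

lemma mem_vanishing {S : Finset ι} {c : ι → F} : c ∈ vanishing F S ↔ ∀ i ∈ S, c i = 0 := by
  simp [vanishing, LinearMap.mem_ker, funext_iff, LinearMap.funLeft_apply]

lemma finrank_puncture_add [Finite ι] (C : Submodule F (ι → F)) (S : Finset ι) :
    finrank F (puncture C S) + finrank F ↥(C ⊓ vanishing F S) = finrank F C := by
  have h := LinearMap.finrank_range_add_finrank_ker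
    ((LinearMap.funLeft F F (Subtype.val : S → ι)).domRestrict C)
  rw [LinearMap.range_domRestrict, LinearMap.ker_domRestrict] at h
  rw [← h, puncture, vanishing]
  congr 1
  rw [← Submodule.finrank_map_subtype_eq, Submodule.map_comap_subtype]

lemma finrank_puncture_le_card (C : Submodule F (ι → F)) (S : Finset ι) :
    finrank F (puncture C S) ≤ S.card := by
  simpa using Submodule.finrank_le (puncture C S)

lemma finrank_puncture_mono [Finite ι] {C D : Submodule F (ι → F)} (hCD : C ≤ D)
    {S T : Finset ι} (hST : S ⊆ T) :
    finrank F (puncture C S) ≤ finrank F (puncture D T) := by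
  have h1 : finrank F (puncture C S) ≤ finrank F (puncture D S) :=
    Submodule.finrank_mono (Submodule.map_mono hCD)
  have h2 : finrank F ↥(D ⊓ vanishing F T) ≤ finrank F ↥(D ⊓ vanishing F S) :=
    Submodule.finrank_mono (inf_le_inf_left _ fun c hc =>
      mem_vanishing.2 fun i hi => mem_vanishing.1 hc i (hST hi))
  have h3 := finrank_puncture_add D S
  have h4 := finrank_puncture_add D T
  omega

lemma finrank_puncture_pos_iff [Finite ι] {C : Submodule F (ι → F)} {S : Finset ι} :
    1 ≤ finrank F (puncture C S) ↔ ∃ c ∈ C, ∃ i ∈ S, c i ≠ 0 := by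
  rw [Nat.one_le_iff_ne_zero, Ne, Submodule.finrank_eq_zero, puncture, ← le_bot_iff,
    Submodule.map_le_iff_le_comap]
  change ¬ C ≤ vanishing F S ↔ _
  simp [SetLike.le_def, mem_vanishing]

/-- Shortening at `T` lowers the dimension by the dimension of `C|_T`. -/
lemma finrank_puncture_shorten [Finite ι] [DecidableEq ι] (C : Submodule F (ι → F))
    {S T : Finset ι} (hTS : T ⊆ S) :
    finrank F (puncture (C ⊓ vanishing F T) (S \ T)) + finrank F (puncture C T) =
      finrank F (puncture C S) := by
  have h1 := finrank_puncture_add C S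
  have h2 := finrank_puncture_add C T
  have h3 := finrank_puncture_add (C ⊓ vanishing F T) (S \ T)
  have h4 : C ⊓ vanishing F T ⊓ vanishing F (S \ T) = C ⊓ vanishing F S := by
    ext c
    simp only [Submodule.mem_inf, mem_vanishing, Finset.mem_sdiff]
    constructor
    · rintro ⟨⟨hc, hT⟩, hS⟩
      exact ⟨hc, fun i hi => if hiT : i ∈ T then hT i hiT else hS i ⟨hi, hiT⟩⟩
    · rintro ⟨hc, hS⟩
      exact ⟨⟨hc, fun i hi => hS i (hTS hi)⟩, fun i hi => hS i hi.1⟩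
  rw [h4] at h3
  omega

lemma finrank_puncture_univ [Fintype ι] (C : Submodule F (ι → F)) :
    finrank F (puncture C Finset.univ) = finrank F C := by
  have h := finrank_puncture_add C Finset.univ
  have h0 : C ⊓ vanishing F Finset.univ = ⊥ := by
    refine le_bot_iff.1 fun c hc => ?_
    exact (Submodule.mem_bot F).2 (funext fun i => mem_vanishing.1 hc.2 i (Finset.mem_univ i))
  rwa [h0, finrank_bot, add_zero] at h

end Rank

/-! ### Minimum weight on a set of coordinates -/

section Weight

variable {F ι : Type*} [Field F] [DecidableEq F]

/-- Every codeword of `C` that is not zero on `S` has at least `d` nonzero coordinates in `S`, that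
is, `C|_S` has minimum distance at least `d`. An integer bound `d` lets puncturing be accounted for
by subtraction, without truncation. -/
def MinWeightOn (C : Submodule F (ι → F)) (S : Finset ι) (d : ℤ) : Prop :=
  ∀ c ∈ C, (∃ i ∈ S, c i ≠ 0) → d ≤ (S.filter fun i => c i ≠ 0).card

lemma minWeightOn_of_le_minDist {C : Submodule F (ι → F)} {S : Finset ι} {d : ℕ}
    (h : (d : ℕ∞) ≤ minDist (puncture C S)) : MinWeightOn C S d := by
  rintro c hc ⟨i, hi, hci⟩
  have h1 : (d : ℕ∞) ≤ (hammingDist (LinearMap.funLeft F F (Subtype.val : S → ι) c) 0 : ℕ) := by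
    refine h.trans ?_
    refine (iInf₂_le _ (Submodule.mem_map_of_mem hc)).trans ?_
    refine (iInf₂_le 0 (Submodule.zero_mem _)).trans (iInf_le _ ?_)
    intro h0
    exact hci (congrFun h0 ⟨i, hi⟩)
  have h2 : d ≤ hammingDist (LinearMap.funLeft F F (Subtype.val : S → ι) c) 0 := by
    exact_mod_cast h1
  rw [hammingDist_zero_right, hammingNorm] at h2
  have h3 : (Finset.univ.filter fun j : S =>
      LinearMap.funLeft F F (Subtype.val : S → ι) c j ≠ 0).card
        ≤ (S.filter fun i => c i ≠ 0).card := by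
    refine Finset.card_le_card_of_injOn Subtype.val ?_ Subtype.val_injective.injOn
    intro j hj
    have hj' : c j ≠ 0 := (Finset.mem_filter.1 hj).2
    simp [hj', j.2]
  exact_mod_cast h2.trans h3

lemma minWeightOn_univ [Fintype ι] {C : Submodule F (ι → F)} {d : ℕ}
    (h : (d : ℕ∞) ≤ minDist C) : MinWeightOn C Finset.univ d := by
  rintro c hc ⟨i, -, hci⟩
  have h1 : (d : ℕ∞) ≤ (hammingDist c 0 : ℕ) := by
    refine h.trans ((iInf₂_le c hc).trans ((iInf₂_le 0 C.zero_mem).trans (iInf_le _ ?_)))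
    rintro rfl
    exact hci rfl
  rw [hammingDist_zero_right, hammingNorm] at h1
  exact_mod_cast h1

lemma MinWeightOn.restrict [DecidableEq ι] {C : Submodule F (ι → F)} {S T : Finset ι} {d : ℤ}
    (h : MinWeightOn C S d) (hTS : T ⊆ S) : MinWeightOn C T (d - (S.card - T.card)) := by
  rintro c hc ⟨i, hi, hci⟩
  have h1 := h c hc ⟨i, hTS hi, hci⟩
  have h2 : (S.filter fun i => c i ≠ 0) ⊆ (T.filter fun i => c i ≠ 0) ∪ (S \ T) := by
    intro j hj
    by_cases hjT : j ∈ T <;> simp_all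
  have h3 := (Finset.card_le_card h2).trans (Finset.card_union_le _ _)
  have h4 := Finset.card_sdiff_add_card_eq_card hTS
  omega

lemma MinWeightOn.shorten [DecidableEq ι] {C : Submodule F (ι → F)} {S T : Finset ι} {d : ℤ}
    (h : MinWeightOn C S d) : MinWeightOn (C ⊓ vanishing F T) (S \ T) d := by
  rintro c ⟨hc, hcT⟩ ⟨i, hi, hci⟩
  refine (h c hc ⟨i, (Finset.mem_sdiff.1 hi).1, hci⟩).trans ?_
  refine Nat.cast_le.2 (Finset.card_le_card fun j hj => ?_)
  rw [Finset.mem_filter] at hj ⊢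
  exact ⟨Finset.mem_sdiff.2 ⟨hj.1, fun hjT => hj.2 (mem_vanishing.1 hcT j hjT)⟩, hj.2⟩

/-- The Singleton bound for `C|_S`. -/
lemma MinWeightOn.singleton_bound [Finite ι] {C : Submodule F (ι → F)} {S : Finset ι} {d : ℤ}
    (h : MinWeightOn C S d) (hk : 1 ≤ finrank F (puncture C S)) :
    d + finrank F (puncture C S) ≤ S.card + 1 := by
  classical
  obtain ⟨c, hc, i, hi, hci⟩ := finrank_puncture_pos_iff.1 hk
  have hd : d ≤ S.card :=
    (h c hc ⟨i, hi, hci⟩).trans (Nat.cast_le.2 (Finset.card_filter_le _ _))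
  rcases le_or_gt d 0 with h0 | h0
  · have := finrank_puncture_le_card C S
    omega
  -- Deleting `d - 1` coordinates leaves the dimension unchanged.
  obtain ⟨X, hXS, hX⟩ := Finset.exists_subset_card_eq (s := S) (n := (d - 1).toNat) (by omega)
  have h1 := finrank_puncture_shorten C (S := S) (T := S \ X) Finset.sdiff_subset
  have h2 : finrank F (puncture (C ⊓ vanishing F (S \ X)) (S \ (S \ X))) = 0 := by
    by_contra hne
    obtain ⟨c, hc, j, hj, hcj⟩ := finrank_puncture_pos_iff.1 (Nat.one_le_iff_ne_zero.2 hne)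
    have h3 := h.shorten (T := S \ X) c hc ⟨j, hj, hcj⟩
    have h4 := Finset.card_filter_le (S \ (S \ X)) fun i => c i ≠ 0
    rw [Finset.sdiff_sdiff_eq_self hXS] at h3 h4
    omega
  have h3 := finrank_puncture_le_card C (S \ X)
  have h4 := Finset.card_sdiff_add_card_eq_card hXS
  omega

end Weight

/-! ### Hierarchical locality along a list of levels -/

section Locality

variable {F ι : Type*} [Field F] [DecidableEq F]

/-- Hierarchical locality of `C|_S` for a list of parameters `(r, δ)`, the outermost level first.
There may be no level at all, which makes the condition empty. -/
def LocalityList (C : Submodule F (ι → F)) : List (ℕ × ℕ) → Finset ι → Prop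
  | [], _ => True
  | p :: L, S => ∀ i ∈ S, ∃ T ⊆ S, i ∈ T ∧
      finrank F (puncture C T) ≤ p.1 ∧ MinWeightOn C T p.2 ∧ LocalityList C L T

lemma HierarchicalLocalityOn.localityList {C : Submodule F (ι → F)} {m : ℕ}
    {r δ : Fin (m + 1) → ℕ} {S : Finset ι} (h : HierarchicalLocalityOn C m r δ S) :
    LocalityList C (List.ofFn fun l => (r l, δ l)) S := by
  induction m generalizing S with
  | zero =>
    intro i hi
    obtain ⟨T, hTS, hiT, hr, hδ⟩ := h i hi
    exact ⟨T, hTS, hiT, hr, minWeightOn_of_le_minDist hδ, trivial⟩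
  | succ m ih =>
    rw [List.ofFn_succ]
    intro i hi
    obtain ⟨T, hTS, hiT, hr, hδ, hT⟩ := h i hi
    exact ⟨T, hTS, hiT, hr, minWeightOn_of_le_minDist hδ, ih hT⟩

lemma LocalityList.shorten [Finite ι] [DecidableEq ι] {C : Submodule F (ι → F)}
    {L : List (ℕ × ℕ)} {S : Finset ι} (h : LocalityList C L S) (T : Finset ι) :
    LocalityList (C ⊓ vanishing F T) L (S \ T) := by
  induction L generalizing S with
  | nil => trivial
  | cons p L ih =>
    intro i hi
    obtain ⟨hiS, hiT⟩ := Finset.mem_sdiff.1 hi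
    obtain ⟨U, hUS, hiU, hr, hδ, hU⟩ := h i hiS
    exact ⟨U \ T, Finset.sdiff_subset_sdiff hUS le_rfl, Finset.mem_sdiff.2 ⟨hiU, hiT⟩,
      (finrank_puncture_mono inf_le_left Finset.sdiff_subset).trans hr, hδ.shorten, ih hU⟩

/-- Replaces every dimension in the list by its minimum with `R` and the preceding dimensions. -/
def capDim : ℕ → List (ℕ × ℕ) → List (ℕ × ℕ)
  | _, [] => []
  | R, p :: L => (min R p.1, p.2) :: capDim (min R p.1) L

/-- The distance of the outermost level. With no level it is `1`, the distance that every code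
has. -/
def outerDist : List (ℕ × ℕ) → ℕ
  | [] => 1
  | p :: _ => p.2

/-- Replaces every distance in the list by its maximum with the distances that follow. -/
def raiseDist : List (ℕ × ℕ) → List (ℕ × ℕ)
  | [] => []
  | p :: L => (p.1, max p.2 (outerDist (raiseDist L))) :: raiseDist L

/-- An inner local code is no larger than the outer ones that contain it. -/
lemma LocalityList.capDim [Finite ι] {C : Submodule F (ι → F)} {L : List (ℕ × ℕ)} {R : ℕ}
    {S : Finset ι} (h : LocalityList C L S) (hR : finrank F (puncture C S) ≤ R) :
    LocalityList C (capDim R L) S := by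
  induction L generalizing S R with
  | nil => trivial
  | cons p L ih =>
    intro i hi
    obtain ⟨T, hTS, hiT, hr, hδ, hT⟩ := h i hi
    have hT' : finrank F (puncture C T) ≤ min R p.1 :=
      le_min ((finrank_puncture_mono le_rfl hTS).trans hR) hr
    exact ⟨T, hTS, hiT, hT', hδ, ih hT hT'⟩

/-- A codeword that is nonzero on an outer local code is nonzero on an inner one. -/
lemma LocalityList.raiseDist {C : Submodule F (ι → F)} {L : List (ℕ × ℕ)} {S : Finset ι}
    (h : LocalityList C L S) :
    LocalityList C (raiseDist L) S ∧ MinWeightOn C S (outerDist (HierLoc.raiseDist L)) := by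
  induction L generalizing S with
  | nil =>
    refine ⟨trivial, ?_⟩
    rintro c - ⟨i, hi, hci⟩
    have : 0 < (S.filter fun i => c i ≠ 0).card :=
      Finset.card_pos.2 ⟨i, Finset.mem_filter.2 ⟨hi, hci⟩⟩
    simp only [HierLoc.raiseDist, outerDist]
    omega
  | cons p L ih =>
    have key : LocalityList C (HierLoc.raiseDist (p :: L)) S := by
      intro i hi
      obtain ⟨T, hTS, hiT, hr, hδ, hT⟩ := h i hi
      refine ⟨T, hTS, hiT, hr, ?_, (ih hT).1⟩
      intro c hc hne
      have h1 := hδ c hc hne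
      have h2 := (ih hT).2 c hc hne
      push_cast
      exact max_le h1 h2
    refine ⟨key, ?_⟩
    rintro c hc ⟨i, hi, hci⟩
    obtain ⟨T, hTS, hiT, -, hδ, -⟩ := key i hi
    exact (hδ c hc ⟨i, hiT, hci⟩).trans
      (Nat.cast_le.2 (Finset.card_le_card (Finset.filter_subset_filter _ hTS)))

end Locality

/-! ### The gain of a list of levels -/

/-- The loss of distance, compared with the Singleton bound, that the levels in the list force on a
code of dimension `k`. -/
def gain : List (ℕ × ℕ) → ℕ → ℤ
  | [], _ => 0
  | p :: L, k => (⌈(k : ℚ) / p.1⌉ - 1) * ((p.2 : ℤ) - outerDist L) + gain L k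

/-- The distances in the list decrease, and all of them are positive. -/
def DistAntitone : List (ℕ × ℕ) → Prop
  | [] => True
  | p :: L => outerDist L ≤ p.2 ∧ DistAntitone L

/-- The dimensions in the list decrease and lie between `1` and `R`. -/
def DimAntitone : ℕ → List (ℕ × ℕ) → Prop
  | _, [] => True
  | R, p :: L => 1 ≤ p.1 ∧ p.1 ≤ R ∧ DimAntitone p.1 L

lemma ceil_div_mono {k r s : ℕ} (hr : 1 ≤ r) (hrs : r ≤ s) :
    ⌈(k : ℚ) / s⌉ ≤ ⌈(k : ℚ) / r⌉ := by
  refine Int.ceil_mono ?_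
  have : (0 : ℚ) < r := by exact_mod_cast hr
  gcongr

lemma one_le_ceil_div {k r : ℕ} (hk : 1 ≤ k) (hr : 1 ≤ r) : 1 ≤ ⌈(k : ℚ) / r⌉ := by
  have h1 : (0 : ℚ) < k := by exact_mod_cast hk
  have h2 : (0 : ℚ) < r := by exact_mod_cast hr
  exact Int.one_le_ceil_iff.2 (by positivity)

lemma ceil_div_eq_one {k r : ℕ} (hk : 1 ≤ k) (hkr : k ≤ r) : ⌈(k : ℚ) / r⌉ = 1 := by
  refine le_antisymm (Int.ceil_le.2 ?_) (one_le_ceil_div hk (hk.trans hkr))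
  have h2 : (0 : ℚ) < r := by exact_mod_cast hk.trans hkr
  rw [div_le_iff₀ h2]
  push_cast
  rw [one_mul]
  exact_mod_cast hkr

lemma gain_cons_of_le {p : ℕ × ℕ} {L : List (ℕ × ℕ)} {k : ℕ} (hk : 1 ≤ k) (hkr : k ≤ p.1) :
    gain (p :: L) k = gain L k := by
  simp [gain, ceil_div_eq_one hk hkr]

lemma gain_add_le {L : List (ℕ × ℕ)} (hL : DistAntitone L) (a b : ℕ) :
    gain L (a + b) ≤ gain L a + gain L b + (outerDist L - 1) := by
  induction L with
  | nil => simp [gain, outerDist]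
  | cons p L ih =>
    have h1 := ih hL.2
    have h2 : ⌈((a + b : ℕ) : ℚ) / p.1⌉ ≤ ⌈(a : ℚ) / p.1⌉ + ⌈(b : ℚ) / p.1⌉ := by
      rw [Nat.cast_add, add_div]
      exact Int.ceil_add_le _ _
    have h3 : (0 : ℤ) ≤ (p.2 : ℤ) - outerDist L := by
      have := hL.1
      omega
    have h4 := mul_le_mul_of_nonneg_right h2 h3
    simp only [gain]
    rw [show outerDist (p :: L) = p.2 from rfl]
    linarith

lemma outerDist_le_raiseDist (L : List (ℕ × ℕ)) : outerDist L ≤ outerDist (raiseDist L) := by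
  cases L with
  | nil => exact le_rfl
  | cons p L => exact le_max_left _ _

lemma distAntitone_raiseDist (L : List (ℕ × ℕ)) : DistAntitone (raiseDist L) := by
  induction L with
  | nil => trivial
  | cons p L ih => exact ⟨le_max_right _ _, ih⟩

lemma outerDist_capDim (R : ℕ) (L : List (ℕ × ℕ)) : outerDist (capDim R L) = outerDist L := by
  cases L <;> rfl

lemma dimAntitone_capDim {R : ℕ} {L : List (ℕ × ℕ)} (hR : 1 ≤ R) (hL : ∀ p ∈ L, 1 ≤ p.1) :
    DimAntitone R (capDim R L) := by
  induction L generalizing R with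
  | nil => trivial
  | cons p L ih =>
    have h1 : 1 ≤ min R p.1 := le_min hR (hL p List.mem_cons_self)
    exact ⟨h1, min_le_left _ _, ih h1 fun q hq => hL q (List.mem_cons_of_mem _ hq)⟩

lemma capDim_eq_self {R : ℕ} {L : List (ℕ × ℕ)} (hL : DimAntitone R L) : capDim R L = L := by
  induction L generalizing R with
  | nil => rfl
  | cons p L ih =>
    obtain ⟨-, h2, h3⟩ := hL
    simp [capDim, min_eq_right h2, ih h3]

lemma gain_le_gain_capDim {R k : ℕ} {L : List (ℕ × ℕ)} (hR : 1 ≤ R) (hL : ∀ p ∈ L, 1 ≤ p.1)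
    (hδ : DistAntitone L) : gain L k ≤ gain (capDim R L) k := by
  induction L generalizing R with
  | nil => exact le_rfl
  | cons p L ih =>
    have h1 : 1 ≤ min R p.1 := le_min hR (hL p List.mem_cons_self)
    have h2 := ih h1 (fun q hq => hL q (List.mem_cons_of_mem _ hq)) hδ.2
    have h3 : (0 : ℤ) ≤ (p.2 : ℤ) - outerDist L := by
      have := hδ.1
      omega
    have h4 := mul_le_mul_of_nonneg_right (ceil_div_mono (k := k) h1 (min_le_right R p.1)) h3
    simp only [gain, capDim, outerDist_capDim]
    linarith

/-- Raising the distances does not decrease the gain. The second summand, a strengthening needed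
for the induction, is the amount by which the term of a level of dimension `R` in front of `L` is
lowered. -/
lemma gain_add_le_gain_raiseDist {R k : ℕ} {L : List (ℕ × ℕ)} (hL : DimAntitone R L) :
    gain L k + (⌈(k : ℚ) / R⌉ - 1) * ((outerDist (raiseDist L) : ℤ) - outerDist L) ≤
      gain (raiseDist L) k := by
  induction L generalizing R with
  | nil => simp [gain, raiseDist]
  | cons p L ih =>
    obtain ⟨h1, h2, h3⟩ := hL
    have h4 := ih h3
    have h5 : (0 : ℤ) ≤ (outerDist (raiseDist (p :: L)) : ℤ) - outerDist (p :: L) := by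
      have := outerDist_le_raiseDist (p :: L)
      omega
    have h6 := mul_le_mul_of_nonneg_right (ceil_div_mono (k := k) h1 h2) h5
    have h7 : outerDist (raiseDist (p :: L)) = max p.2 (outerDist (raiseDist L)) := rfl
    have h8 : outerDist (p :: L) = p.2 := rfl
    rw [h7, h8] at h6 ⊢
    simp only [gain, raiseDist]
    linarith

lemma gain_le_gain_raiseDist {R k : ℕ} {L : List (ℕ × ℕ)} (hk : 1 ≤ k) (hR : 1 ≤ R)
    (hL : DimAntitone R L) : gain L k ≤ gain (raiseDist L) k := by
  have h1 := gain_add_le_gain_raiseDist (k := k) hL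
  have h2 := one_le_ceil_div hk hR
  have h3 := outerDist_le_raiseDist L
  have h4 : 0 ≤ (⌈(k : ℚ) / R⌉ - 1) * ((outerDist (raiseDist L) : ℤ) - outerDist L) :=
    mul_nonneg (by omega) (by omega)
  linarith

/-! ### The bound -/

/-- The generalized Singleton bound for decreasing distances. -/
theorem LocalityList.singleton_bound {F ι : Type*} [Field F] [DecidableEq F] [Finite ι]
    {L : List (ℕ × ℕ)} (hL : DistAntitone L) {C : Submodule F (ι → F)} {S : Finset ι} {d : ℤ}
    (hloc : LocalityList C L S) (hd : MinWeightOn C S d) (hk : 1 ≤ finrank F (puncture C S)) :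
    d + finrank F (puncture C S) + gain L (finrank F (puncture C S)) ≤ S.card + 1 := by
  classical
  induction L generalizing C S d with
  | nil => simpa [gain] using MinWeightOn.singleton_bound hd hk
  | cons p L ihL =>
    induction hn : finrank F (puncture C S) using Nat.strong_induction_on generalizing C S with
    | _ k ihk =>
      obtain ⟨c, hc, i, hi, hci⟩ := finrank_puncture_pos_iff.1 hk
      obtain ⟨T, hTS, hiT, hr, hδ, hT⟩ := hloc i hi
      have hTpos : 1 ≤ finrank F (puncture C T) :=
        finrank_puncture_pos_iff.2 ⟨c, hc, i, hiT, hci⟩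
      rcases (finrank_puncture_mono (le_refl C) hTS).eq_or_lt with heq | hlt
      · have h1 := ihL hL.2 hT (hd.restrict hTS) hTpos
        rw [heq, hn] at h1 hr
        rw [hn] at hk
        rw [gain_cons_of_le hk hr]
        linarith
      · have h1 := finrank_puncture_shorten C hTS
        have h2 := ihk (finrank F (puncture (C ⊓ vanishing F T) (S \ T))) (by omega)
          (hloc.shorten T) hd.shorten (by omega) rfl
        have h3 := ihL hL.2 hT hδ hTpos
        have h4 := gain_add_le hL (finrank F (puncture (C ⊓ vanishing F T) (S \ T)))
          (finrank F (puncture C T))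
        rw [h1, gain_cons_of_le hTpos hr, hn] at h4
        have h5 := Finset.card_sdiff_add_card_eq_card hTS
        have h6 : outerDist (p :: L) = p.2 := rfl
        rw [h6] at h4
        omega

lemma outerDist_ofFn {m : ℕ} (r δ : Fin (m + 1) → ℕ) :
    outerDist (List.ofFn fun l => (r l, δ l)) = δ 0 := by
  rw [List.ofFn_succ]
  rfl

lemma gain_ofFn {m : ℕ} (r δ : Fin (m + 1) → ℕ) (k : ℕ) :
    gain (List.ofFn fun l => (r l, δ l)) k =
      ∑ l : Fin m, (⌈(k : ℚ) / r l.castSucc⌉ - 1) * ((δ l.castSucc : ℤ) - δ l.succ)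
      + (⌈(k : ℚ) / r (Fin.last m)⌉ - 1) * ((δ (Fin.last m) : ℤ) - 1) := by
  induction m with
  | zero => simp [gain, outerDist]
  | succ m ih =>
    rw [List.ofFn_succ, gain, ih (fun l => r l.succ) (fun l => δ l.succ),
      outerDist_ofFn (fun l => r l.succ) (fun l => δ l.succ), Fin.sum_univ_succ, ← add_assoc]
    rfl

lemma distAntitone_ofFn {m : ℕ} {r δ : Fin (m + 1) → ℕ} (hδ : ∀ l, 1 ≤ δ l)
    (h : Antitone δ) : DistAntitone (List.ofFn fun l => (r l, δ l)) := by
  induction m with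
  | zero => exact ⟨hδ 0, trivial⟩
  | succ m ih =>
    rw [List.ofFn_succ]
    refine ⟨?_, ih (fun l => hδ l.succ) fun a b hab => h (Fin.succ_le_succ_iff.2 hab)⟩
    rw [outerDist_ofFn (fun l => r l.succ) (fun l => δ l.succ)]
    exact h (Fin.zero_le _)

lemma dimAntitone_ofFn {m R : ℕ} {r δ : Fin (m + 1) → ℕ} (hr : ∀ l, 1 ≤ r l)
    (h : Antitone r) (hR : r 0 ≤ R) : DimAntitone R (List.ofFn fun l => (r l, δ l)) := by
  induction m generalizing R with
  | zero => exact ⟨hr 0, hR, trivial⟩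
  | succ m ih =>
    rw [List.ofFn_succ]
    exact ⟨hr 0, hR, ih (r := fun l => r l.succ) (δ := fun l => δ l.succ) (fun l => hr l.succ)
      (fun a b hab => h (Fin.succ_le_succ_iff.2 hab)) (h (Fin.zero_le _))⟩

/-- With two levels, capping only changes the dimension of the inner one, whose distance is at least
`1`. -/
lemma gain_le_gain_capDim_pair {R k : ℕ} {p q : ℕ × ℕ} (hp : 1 ≤ p.1) (hq : 1 ≤ q.1)
    (hδ : 1 ≤ q.2) (hR : p.1 ≤ R) : gain [p, q] k ≤ gain (capDim R [p, q]) k := by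
  have h : gain [q] k ≤ gain (capDim p.1 [q]) k :=
    gain_le_gain_capDim hp (by simpa using hq) ⟨hδ, trivial⟩
  rw [capDim, min_eq_right hR]
  exact add_le_add le_rfl h

end HierLoc

open HierLoc in
theorem mainTheorem2 {F : Type*} [Field F] [DecidableEq F] (n k d m : ℕ)
    (C : Submodule F (Fin n → F)) (hC : HierLoc.IsLinearCode n k d C)
    (r δ : Fin (m + 1) → ℕ) (hr : ∀ l, 1 ≤ r l) (hδ : ∀ l, 1 ≤ δ l)
    (hmono : 3 ≤ m + 1 → Antitone r ∨ Antitone δ)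
    (hloc : HierLoc.HasHierarchicalLocality C m r δ) :
    (d : ℤ) ≤ (n : ℤ) - k + 1
      - ∑ l : Fin m, (⌈(k : ℚ) / r l.castSucc⌉ - 1) * ((δ l.castSucc : ℤ) - δ l.succ)
      - (⌈(k : ℚ) / r (Fin.last m)⌉ - 1) * ((δ (Fin.last m) : ℤ) - 1) := by
  have hdim : Module.finrank F (puncture C Finset.univ) = k :=
    (finrank_puncture_univ C).trans hC.dim_eq
  -- A code of finite minimum distance is not zero.
  have hk : 1 ≤ k := by
    by_contra hk0
    have h0 : C = ⊥ := Submodule.finrank_eq_zero.1 (by rw [hC.dim_eq]; omega)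
    have htop : minDist C = ⊤ := by
      simp [minDist, h0]
    exact ENat.natCast_ne_top d (hC.minDist_eq.symm.trans htop)
  set L : List (ℕ × ℕ) := List.ofFn fun l => (r l, δ l) with hLdef
  have hL : ∀ p ∈ L, 1 ≤ p.1 := by
    intro p hp
    obtain ⟨l, rfl⟩ := List.mem_ofFn.1 hp
    exact hr l
  -- Any bound that is at least `k` and `r 0` may be used to start capping the dimensions.
  set R := k + r 0
  have hR : 1 ≤ R := by omega
  have hcap : gain L k ≤ gain (capDim R L) k := by
    have hcases : Antitone r ∨ Antitone δ ∨ m = 1 := by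
      rcases lt_trichotomy m 1 with h | h | h
      · obtain rfl : m = 0 := by omega
        exact Or.inl fun a b _ => (congrArg r (Subsingleton.elim (α := Fin 1) b a)).le
      · exact Or.inr (Or.inr h)
      · exact (hmono (by omega)).imp_right Or.inl
    rcases hcases with h | h | rfl
    · rw [capDim_eq_self (dimAntitone_ofFn hr h (by omega))]
    · exact gain_le_gain_capDim hR hL (distAntitone_ofFn hδ h)
    · have hpair : L = [(r 0, δ 0), (r 1, δ 1)] := by simp [hLdef, List.ofFn_succ]
      rw [hpair]
      exact gain_le_gain_capDim_pair (hr 0) (hr 1) (hδ 1) (Nat.le_add_left _ _)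
  have hraise := gain_le_gain_raiseDist hk hR (dimAntitone_capDim hR hL)
  have hlist : LocalityList C (capDim R L) Finset.univ :=
    (HierarchicalLocalityOn.localityList hloc).capDim (by omega)
  have hbound := hlist.raiseDist.1.singleton_bound (distAntitone_raiseDist _)
    (minWeightOn_univ hC.minDist_eq.ge) (by omega)
  rw [hdim, Finset.card_univ, Fintype.card_fin] at hbound
  have hgain := gain_ofFn r δ k
  linarith
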